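/- Let $\mathbb{C}_\theta=\{s\in\mathbb{C}:\Re s>\theta\}$ and $\mathbb{C}_+=\mathbb{C}_0$. Let $h:(0,\infty)\to[0,\infty)$ be integrable with $\int_0^\infty h=1$ and such that $0$ belongs to the support of the measure $d\mu=h(\sigma)\,d\sigma$, i.e. $\int_0^\varepsilon h>0$ for every $\varepsilon>0$. Put $w_h(n)=\int_0^\infty n^{-2\sigma}h(\sigma)\,d\sigma$ for $n\ge1$, and let $\mathcal{A}^2_\mu$ be the space of Dirichlet series $f(s)=\sum_{n\ge1}a_nn^{-s}$ with $\|f\|^2=\sum_{n\ge1}|a_n|^2w_h(n)<\infty$; these series converge on $\mathbb{C}_{1/2}$. Put $$\beta_h(\sigma)=\int_0^\sigma(\sigma-u)h(u)\,du\qquad(\sigma>0).$$ Let $c_0\ge1$ be an integer and let $\Phi$ be a $c_0$-symbol, that is, an analytic function $\Phi:\mathbb{C}_{1/2}\to\mathbb{C}_{1/2}$ of the form $\Phi(s)=c_0s+\varphi(s)$, where $\varphi$ is represented by a convergent Dirichlet series in some half-plane, such that the composition operator $C_\Phi:f\mapsto f\circ\Phi$ is a bounded operator from $\mathcal{A}^2_\mu$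 to itself. Then $\Phi$ extends to an analytic function on $\mathbb{C}_+$ (uniquely; the extension is still denoted by $\Phi$), and for every $s\in\mathbb{C}_+$ the generalized Nevanlinna counting function $$N_{\beta_h,\Phi}(s)=\sum_{a\in\mathbb{C}_+,\ \Phi(a)=s}\beta_h(\Re a)$$ (the sum is over the distinct points $a$, and is $0$ if $s\notin\Phi(\mathbb{C}_+)$) satisfies $$N_{\beta_h,\Phi}(s)\le\frac{\beta_h(\Re s)}{c_0}.$$ In particular the sum converges. -/

import Mathlib

open Filter Topology Set MeasureTheory
open scoped ENNReal NNReal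

noncomputable section

namespace DirichletBergman

/-- The open half-plane `ℂ_θ = {s : Re s > θ}`; `ℂ_+` is `halfPlane 0`. -/
def halfPlane (θ : ℝ) : Set ℂ := {s : ℂ | θ < s.re}

/-- `h` is the density on `(0, ∞)` of a probability measure `μ` with `0 ∈ Supp μ`. -/
structure IsAdmissibleDensity (h : ℝ → ℝ) : Prop where
  nonneg : ∀ σ : ℝ, 0 < σ → 0 ≤ h σ
  integrableOn : IntegrableOn h (Ioi 0)
  integral_eq_one : ∫ σ in Ioi (0 : ℝ), h σ = 1
  zero_mem_support : ∀ ε : ℝ, 0 < ε → 0 < ∫ σ in Ioo (0 : ℝ) ε, h σ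

/-- On the half-plane `ℂ_θ`, the Dirichlet series `∑_{n ≥ 1} a n * n ^ (-s)` converges
(in the ordinary, possibly conditional, sense) and its sum is `f s`. The value `a 0` is unused. -/
def IsDirichletExpansion (a : ℕ → ℂ) (f : ℂ → ℂ) (θ : ℝ) : Prop :=
  ∀ s ∈ halfPlane θ,
    Tendsto (fun N : ℕ => ∑ n ∈ Finset.Icc 1 N, a n * (n : ℂ) ^ (-s)) atTop (𝓝 (f s))

/-- The class `𝒟`: functions represented by a convergent Dirichlet series in some half-plane. -/
def IsDirichletRepresentable (f : ℂ → ℂ) : Prop :=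
  ∃ (a : ℕ → ℂ) (θ : ℝ), IsDirichletExpansion a f θ

/-- The weight `w_h(n) = ∫_0^∞ n^{-2σ} h(σ) dσ`. -/
def weight (h : ℝ → ℝ) (n : ℕ) : ℝ :=
  ∫ σ in Ioi (0 : ℝ), (n : ℝ) ^ (-2 * σ) * h σ

/-- The squared norm `∑_{n ≥ 1} |a n|² w_h(n)` in `𝒜²_μ`, `dμ = h dσ`, of the Dirichlet series
with coefficients `a` (infinite when the series is not in the space). -/
def normSq (h : ℝ → ℝ) (a : ℕ → ℂ) : ℝ≥0∞ :=
  ∑' n : ℕ+, ‖a n‖ₑ ^ 2 * ENNReal.ofReal (weight h n)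

/-- The function `f` on `ℂ_{1/2}` is the element of the weighted Bergman space `𝒜²_μ`
whose Dirichlet coefficients are `a`. -/
def IsBergmanElement (h : ℝ → ℝ) (a : ℕ → ℂ) (f : ℂ → ℂ) : Prop :=
  normSq h a < ∞ ∧ IsDirichletExpansion a f (1 / 2)

/-- The composition operator `f ↦ f ∘ Φ` maps `𝒜²_μ` to itself and is bounded. -/
def IsBoundedComposition (h : ℝ → ℝ) (Φ : ℂ → ℂ) : Prop :=
  ∃ C : ℝ≥0, ∀ (a : ℕ → ℂ) (f : ℂ → ℂ), IsBergmanElement h a f →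
    ∃ b : ℕ → ℂ, IsBergmanElement h b (f ∘ Φ) ∧ normSq h b ≤ (C : ℝ≥0∞) ^ 2 * normSq h a

/-- `c₀`-symbols: analytic maps `Φ : ℂ_{1/2} → ℂ_{1/2}` of the form `Φ(s) = c₀ s + φ(s)` with
`φ ∈ 𝒟` that induce a bounded composition operator on `𝒜²_μ`.
Only the values of `Φ` on `ℂ_{1/2}` matter. -/
structure IsSymbol (h : ℝ → ℝ) (c₀ : ℕ) (Φ : ℂ → ℂ) : Prop where
  differentiableOn : DifferentiableOn ℂ Φ (halfPlane (1 / 2))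
  mapsTo : MapsTo Φ (halfPlane (1 / 2)) (halfPlane (1 / 2))
  form : ∃ φ : ℂ → ℂ, IsDirichletRepresentable φ ∧
    ∀ s ∈ halfPlane (1 / 2), Φ s = c₀ * s + φ s
  bounded : IsBoundedComposition h Φ

/-- `Ψ` is an analytic extension of `Φ` from `ℂ_{1/2}` to `ℂ_+` (unique on `ℂ_+`). -/
def IsAnalyticExtension (Φ Ψ : ℂ → ℂ) : Prop :=
  DifferentiableOn ℂ Ψ (halfPlane 0) ∧ EqOn Ψ Φ (halfPlane (1 / 2))

/-- `β_h(σ) = ∫_0^σ (σ - u) h(u) du`. -/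
def betaFun (h : ℝ → ℝ) (σ : ℝ) : ℝ :=
  ∫ u in (0 : ℝ)..σ, (σ - u) * h u

/-- The generalized Nevanlinna counting function
`N_{β,Ψ}(s) = ∑_{a ∈ ℂ_+, Ψ(a) = s} β(Re a)`, which is `0` for `s ∉ Ψ(ℂ_+)`. -/
def nevanlinna (β : ℝ → ℝ) (Ψ : ℂ → ℂ) (s : ℂ) : ℝ≥0∞ :=
  ∑' a : {a : ℂ // a ∈ halfPlane 0 ∧ Ψ a = s}, ENNReal.ofReal (β (a : ℂ).re)

end DirichletBergman

end

noncomputable section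

open scoped ComplexConjugate

namespace DirichletBergman

/-! Extension. For q = 2, 3 the powers (q^{-Φ})^k are the images under C_Φ of q^{-ks}, hence bounded
in norm uniformly in k, because w_h ≤ 1. As 0 lies in the support of μ, w_h(n) is at least a
positive multiple of n^{-σ} for each σ > 0. On series supported on d-smooth integers this makes
point evaluations bounded throughout ℂ_+, by Cauchy–Schwarz and a finite Euler product. Passing to
the smooth part respects products, so bounded powers force modulus at most 1
(`norm_LSeries_smoothPart_le_one`). Letting d → ∞, with the three lines theorem for convergence,
extends q^{-Φ} to ℂ_+ with bound 1 (`exists_bounded_extension_of_powers`). At a common point the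
orders of vanishing for q = 2 and q = 3 are in the ratio log 2 : log 3, which is irrational, so
there are no zeros (`ne_zero_of_extensions`). A logarithm then yields Ψ, and the maximum principle
makes it a self-map of ℂ_+.

Counting. The function (Ψ - w)/(Ψ + conj w) is dominated by the Blaschke product over any finite set
of preimages a of w. Comparing the defects from modulus 1 along x → +∞, where Ψ(x) ∼ c₀x, gives c₀ ∑
Re a ≤ Re w (`mul_sum_re_le`). Applied to Ψ(s + u) - u this becomes c₀ ∑ (Re a - u)⁺ ≤ (Re w - u)⁺
(`mul_sum_max_le`). Integration against h(u) du finishes, since β_h(σ) = ∫ (σ - u)⁺ h(u) du. -/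

/-! ### Schwarz lemma and finite Blaschke products on the right half-plane. -/

lemma mem_halfPlane {θ : ℝ} {s : ℂ} : s ∈ halfPlane θ ↔ θ < s.re := Iff.rfl

lemma isOpen_halfPlane (θ : ℝ) : IsOpen (halfPlane θ) :=
  isOpen_lt continuous_const Complex.continuous_re

lemma convex_halfPlane (θ : ℝ) : Convex ℝ (halfPlane θ) := convex_halfSpace_re_gt θ

lemma isPreconnected_halfPlane (θ : ℝ) : IsPreconnected (halfPlane θ) :=
  (convex_halfPlane θ).isPreconnected

/-- This identity gives both the contractivity of half-plane Blaschke factors and their exact defect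
from modulus 1. -/
lemma sq_norm_sub_eq (s a : ℂ) : ‖s - a‖ ^ 2 = ‖s + conj a‖ ^ 2 - 4 * s.re * a.re := by
  simp only [Complex.sq_norm, Complex.normSq_apply, Complex.sub_re, Complex.sub_im,
    Complex.add_re, Complex.add_im, Complex.conj_re, Complex.conj_im]
  ring

lemma add_conj_ne_zero {s a : ℂ} (hs : s ∈ halfPlane 0) (ha : a ∈ halfPlane 0) :
    s + conj a ≠ 0 := by
  intro h
  have h' := congrArg Complex.re h
  simp only [Complex.add_re, Complex.conj_re, Complex.zero_re] at h'
  rw [mem_halfPlane] at hs ha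
  linarith

lemma norm_sub_lt_norm_add_conj {s a : ℂ} (hs : s ∈ halfPlane 0) (ha : a ∈ halfPlane 0) :
    ‖s - a‖ < ‖s + conj a‖ := by
  have h : 0 < s.re * a.re := mul_pos hs ha
  refine lt_of_pow_lt_pow_left₀ 2 (norm_nonneg _) ?_
  rw [sq_norm_sub_eq]
  linarith

/-- The Möbius map from the unit disc onto the right half-plane that sends `0` to `a`. -/
def cayley (a z : ℂ) : ℂ := (a + conj a * z) / (1 - z)

lemma one_sub_ne_zero_of_mem_ball {z : ℂ} (hz : z ∈ Metric.ball (0 : ℂ) 1) : 1 - z ≠ 0 := by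
  intro h
  rw [sub_eq_zero] at h
  simp [← h] at hz

lemma cayley_mem {a z : ℂ} (ha : a ∈ halfPlane 0) (hz : z ∈ Metric.ball (0 : ℂ) 1) :
    cayley a z ∈ halfPlane 0 := by
  have h1 := one_sub_ne_zero_of_mem_ball hz
  have hz' : ‖z‖ ^ 2 < 1 := by
    rw [mem_ball_zero_iff] at hz
    have := norm_nonneg z
    nlinarith
  rw [Complex.sq_norm, Complex.normSq_apply] at hz'
  rw [mem_halfPlane] at ha
  have h2 : (cayley a z).re = a.re * (1 - (z.re * z.re + z.im * z.im)) / Complex.normSq (1 - z) := by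
    rw [cayley, Complex.div_re, ← add_div]
    congr 1
    simp
    ring
  rw [mem_halfPlane, h2]
  have := Complex.normSq_pos.2 h1
  have : 0 < 1 - (z.re * z.re + z.im * z.im) := by linarith
  positivity

lemma differentiableOn_cayley (a : ℂ) : DifferentiableOn ℂ (cayley a) (Metric.ball 0 1) := by
  intro z hz
  have := one_sub_ne_zero_of_mem_ball hz
  unfold cayley
  refine DifferentiableAt.differentiableWithinAt ?_
  fun_prop (disch := assumption)

lemma cayleyInv_mem {a s : ℂ} (ha : a ∈ halfPlane 0) (hs : s ∈ halfPlane 0) :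
    (s - a) / (s + conj a) ∈ Metric.ball (0 : ℂ) 1 := by
  rw [mem_ball_zero_iff, norm_div, div_lt_one (norm_pos_iff.2 (add_conj_ne_zero hs ha))]
  exact norm_sub_lt_norm_add_conj hs ha

lemma cayley_cayleyInv {a s : ℂ} (ha : a ∈ halfPlane 0) (hs : s ∈ halfPlane 0) :
    cayley a ((s - a) / (s + conj a)) = s := by
  have h1 := add_conj_ne_zero hs ha
  have h2 := one_sub_ne_zero_of_mem_ball (cayleyInv_mem ha hs)
  have h3 := add_conj_ne_zero ha ha
  rw [cayley, div_eq_iff h2]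
  field_simp
  ring

/-- The Schwarz lemma in the right half-plane. -/
lemma norm_mul_le_of_eq_zero {G : ℂ → ℂ} (hG : DifferentiableOn ℂ G (halfPlane 0))
    (hb : ∀ s ∈ halfPlane 0, ‖G s‖ ≤ 1) {a s : ℂ} (ha : a ∈ halfPlane 0) (h0 : G a = 0)
    (hs : s ∈ halfPlane 0) : ‖G s‖ * ‖s + conj a‖ ≤ ‖s - a‖ := by
  have h1 : DifferentiableOn ℂ (G ∘ cayley a) (Metric.ball 0 1) :=
    hG.comp (differentiableOn_cayley a) fun z hz => cayley_mem ha hz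
  have h2 : MapsTo (G ∘ cayley a) (Metric.ball 0 1) (Metric.closedBall 0 1) := fun z hz => by
    simpa using hb _ (cayley_mem ha hz)
  have h3 := Complex.norm_le_norm_of_mapsTo_ball h1 h2 (by simp [cayley, h0])
    (mem_ball_zero_iff.1 (cayleyInv_mem ha hs))
  rw [Function.comp_apply, cayley_cayleyInv ha hs, norm_div] at h3
  rwa [le_div_iff₀ (norm_pos_iff.2 (add_conj_ne_zero hs ha))] at h3

/-- A function bounded by `1` on the right half-plane is dominated by the finite Blaschke product
of any of its zeros. -/
lemma norm_le_prod_of_eq_zero (T : Finset ℂ) : ∀ G : ℂ → ℂ, DifferentiableOn ℂ G (halfPlane 0) →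
    (∀ s ∈ halfPlane 0, ‖G s‖ ≤ 1) → (∀ a ∈ T, a ∈ halfPlane 0 ∧ G a = 0) →
    ∀ s ∈ halfPlane 0, ‖G s‖ ≤ ∏ a ∈ T, ‖s - a‖ / ‖s + conj a‖ := by
  classical
  induction T using Finset.induction_on with
  | empty => intro G _ hb _ s hs; simpa using hb s hs
  | insert a T haT ih =>
    intro G hG hb hz s hs
    obtain ⟨ha, hGa⟩ := hz a (Finset.mem_insert_self a T)
    have hnhds := (isOpen_halfPlane 0).mem_nhds ha
    have hdiff : DifferentiableOn ℂ (fun s => dslope G a s * (s + conj a)) (halfPlane 0) :=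
      ((Complex.differentiableOn_dslope hnhds).2 hG).mul (by fun_prop)
    have hfac : ∀ z, G z = (z - a) * dslope G a z := fun z => by
      simpa [hGa] using (sub_smul_dslope G a z).symm
    have hoff : ∀ z ∈ halfPlane 0, z ≠ a → ‖dslope G a z * (z + conj a)‖ ≤ 1 := by
      intro z hz hza
      have h1 := norm_mul_le_of_eq_zero hG hb ha hGa hz
      have h2 : 0 < ‖z - a‖ := norm_pos_iff.2 (sub_ne_zero.2 hza)
      rw [hfac z, norm_mul, mul_assoc] at h1
      rw [norm_mul]
      exact le_of_mul_le_mul_left (by simpa using h1) h2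
    have hbound : ∀ z ∈ halfPlane 0, ‖dslope G a z * (z + conj a)‖ ≤ 1 := by
      intro z hz
      rcases eq_or_ne z a with rfl | hza
      -- The Schwarz lemma says nothing about the quotient at its own zero; the bound passes there
      -- by continuity.
      · have hc := ((hdiff.differentiableAt hnhds).continuousAt.norm.tendsto).mono_left
          (nhdsWithin_le_nhds (s := {z}ᶜ))
        refine le_of_tendsto hc ?_
        filter_upwards [mem_nhdsWithin_of_mem_nhds hnhds, self_mem_nhdsWithin] with y hy hyz
        exact hoff y hy hyz
      · exact hoff z hz hza
    have hzero : ∀ b ∈ T, b ∈ halfPlane 0 ∧ dslope G a b * (b + conj a) = 0 := by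
      intro b hb
      obtain ⟨h1, h2⟩ := hz b (Finset.mem_insert_of_mem hb)
      refine ⟨h1, ?_⟩
      have hba : b - a ≠ 0 := sub_ne_zero.2 fun h => haT (h ▸ hb)
      rw [hfac b] at h2
      rw [(mul_eq_zero.1 h2).resolve_left hba, zero_mul]
    have key := ih _ hdiff hbound hzero s hs
    rw [Finset.prod_insert haT, hfac s, norm_mul, div_mul_eq_mul_div,
      le_div_iff₀ (norm_pos_iff.2 (add_conj_ne_zero hs ha)), mul_assoc, ← norm_mul]
    exact mul_le_mul_of_nonneg_left key (norm_nonneg _)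

/-! ### Comparison of Blaschke defects at infinity. -/

/-- The defect equals 4 Re w · Re F / |F + conj w|², with F ∼ cx. It is used both for the self-map
and, with c = 1, for the identity. -/
lemma tendsto_mul_one_sub_sq {F : ℝ → ℂ} {c : ℝ} (hc : 0 < c)
    (hF : Tendsto (fun x : ℝ => F x / x) atTop (𝓝 c)) (w : ℂ) (hw : w ∈ halfPlane 0)
    (hpos : ∀ᶠ x in atTop, F x ∈ halfPlane 0) :
    Tendsto (fun x : ℝ => x * (1 - (‖F x - w‖ / ‖F x + conj w‖) ^ 2)) atTop
      (𝓝 (4 * w.re / c)) := by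
  have h0 : Tendsto (fun x : ℝ => conj w / (x : ℂ)) atTop (𝓝 0) := by
    have h := (Complex.continuous_ofReal.tendsto 0).comp tendsto_inv_atTop_zero
    simpa [Function.comp_def, div_eq_mul_inv] using h.const_mul (conj w)
  have h1 : Tendsto (fun x : ℝ => 4 * w.re * (F x / x).re / ‖F x / x + conj w / x‖ ^ 2) atTop
      (𝓝 (4 * w.re * (c : ℂ).re / ‖(c : ℂ) + 0‖ ^ 2)) := by
    refine Tendsto.div (((Complex.continuous_re.tendsto _).comp hF).const_mul _)
      ((hF.add h0).norm.pow 2) ?_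
    simp [hc.ne']
  have h2 : 4 * w.re * (c : ℂ).re / ‖(c : ℂ) + 0‖ ^ 2 = 4 * w.re / c := by
    rw [add_zero, Complex.norm_real, Real.norm_eq_abs, sq_abs, Complex.ofReal_re]
    field_simp
  rw [h2] at h1
  refine h1.congr' ?_
  filter_upwards [hpos, eventually_gt_atTop 0] with x hx hx0
  have h3 : ‖F x + conj w‖ ≠ 0 := norm_ne_zero_iff.2 (add_conj_ne_zero hx hw)
  rw [← add_div, norm_div, Complex.div_ofReal_re, Complex.norm_real, Real.norm_of_nonneg hx0.le,
    div_pow, div_pow, sq_norm_sub_eq]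
  field_simp
  ring

lemma tendsto_one_of_tendsto_mul_one_sub {u : ℝ → ℝ} {L : ℝ}
    (hu : Tendsto (fun x => x * (1 - u x)) atTop (𝓝 L)) : Tendsto u atTop (𝓝 1) := by
  have h := (tendsto_inv_atTop_zero.mul hu).const_sub 1
  rw [zero_mul, sub_zero] at h
  refine h.congr' ?_
  filter_upwards [eventually_ne_atTop 0] with x hx
  field_simp
  ring

/-- First-order defects add up: 1 - uv = (1 - u) + u(1 - v), and each factor tends to 1. -/
lemma tendsto_mul_one_sub_prod {ι : Type*} (T : Finset ι) (u : ι → ℝ → ℝ) (L : ι → ℝ)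
    (h : ∀ i ∈ T, Tendsto (fun x => x * (1 - u i x)) atTop (𝓝 (L i))) :
    Tendsto (fun x => x * (1 - ∏ i ∈ T, u i x)) atTop (𝓝 (∑ i ∈ T, L i)) := by
  classical
  induction T using Finset.induction_on with
  | empty => simp
  | insert i T hi ih =>
    have h1 := h i (Finset.mem_insert_self i T)
    have h2 := h1.add ((tendsto_one_of_tendsto_mul_one_sub h1).mul
      (ih fun j hj => h j (Finset.mem_insert_of_mem hj)))
    rw [Finset.sum_insert hi]
    rw [one_mul] at h2
    refine h2.congr fun x => ?_
    rw [Finset.prod_insert hi]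
    ring

/-- If `F` maps the right half-plane to itself and `F x ∼ c x` as `x → ∞`, then the preimages `a`
of a point `w` satisfy `c ∑ Re a ≤ Re w`. -/
lemma mul_sum_re_le {F : ℂ → ℂ} (hF : DifferentiableOn ℂ F (halfPlane 0))
    (hmaps : MapsTo F (halfPlane 0) (halfPlane 0)) {c : ℝ} (hc : 0 < c)
    (hlim : Tendsto (fun x : ℝ => F x / x) atTop (𝓝 c)) (T : Finset ℂ) {w : ℂ}
    (hw : w ∈ halfPlane 0) (hT : ∀ a ∈ T, a ∈ halfPlane 0 ∧ F a = w) :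
    c * ∑ a ∈ T, a.re ≤ w.re := by
  have hG : DifferentiableOn ℂ (fun s => (F s - w) / (F s + conj w)) (halfPlane 0) :=
    (hF.sub_const w).div (hF.add_const _) fun s hs => add_conj_ne_zero (hmaps hs) hw
  have hbl := norm_le_prod_of_eq_zero T _ hG
    (fun s hs => (mem_ball_zero_iff.1 (cayleyInv_mem hw (hmaps hs))).le)
    (fun a ha => ⟨(hT a ha).1, by simp [(hT a ha).2]⟩)
  have hreal : ∀ᶠ x : ℝ in atTop, (x : ℂ) ∈ halfPlane 0 := by
    filter_upwards [eventually_gt_atTop 0] with x hx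
    simpa [mem_halfPlane] using hx
  have h1 := tendsto_mul_one_sub_sq hc hlim w hw (hreal.mono fun x hx => hmaps hx)
  have hid : Tendsto (fun x : ℝ => (x : ℂ) / x) atTop (𝓝 ((1 : ℝ) : ℂ)) := by
    refine tendsto_const_nhds.congr' ?_
    filter_upwards [eventually_ne_atTop 0] with x hx
    simp [hx]
  have h2 := tendsto_mul_one_sub_prod T (fun a x => (‖(x : ℂ) - a‖ / ‖(x : ℂ) + conj a‖) ^ 2)
    (fun a => 4 * a.re / 1) fun a ha =>
      tendsto_mul_one_sub_sq one_pos hid a (hT a ha).1 hreal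
  -- Squaring the Blaschke bound and subtracting from 1 reverses it; multiply by x and let x → ∞.
  have h3 : ∑ a ∈ T, 4 * a.re / 1 ≤ 4 * w.re / c := by
    refine le_of_tendsto_of_tendsto h2 h1 ?_
    filter_upwards [hreal, eventually_ge_atTop 0] with x hx hx0
    have h := hbl x hx
    rw [Finset.prod_pow]
    rw [norm_div] at h
    gcongr
  simp only [div_one] at h3
  rw [← Finset.mul_sum, le_div_iff₀ hc] at h3
  linarith

/-! ### Conditionally convergent expansions as absolutely convergent L-series. -/

lemma sum_Icc_eq_sum_range_term (a : ℕ → ℂ) (s : ℂ) (N : ℕ) :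
    ∑ n ∈ Finset.Icc 1 N, a n * (n : ℂ) ^ (-s) =
      ∑ n ∈ Finset.range (N + 1), LSeries.term a s n := by
  induction N with
  | zero => simp
  | succ N ih =>
    rw [Finset.sum_Icc_succ_top (by omega), Finset.sum_range_succ, ih,
      LSeries.term_of_ne_zero N.succ_ne_zero, Complex.cpow_neg, div_eq_mul_inv]

lemma IsDirichletExpansion.tendsto_sum_range {a : ℕ → ℂ} {f : ℂ → ℂ} {θ : ℝ}
    (h : IsDirichletExpansion a f θ) {s : ℂ} (hs : θ < s.re) :
    Tendsto (fun N => ∑ n ∈ Finset.range N, LSeries.term a s n) atTop (𝓝 (f s)) := by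
  refine (tendsto_add_atTop_iff_nat 1).1 ((h s hs).congr fun N => ?_)
  exact sum_Icc_eq_sum_range_term a s N

/-- Convergence at a real t > θ makes the terms bounded, so a n = O(n^t), which gives absolute
convergence to the right of t + 1. -/
lemma IsDirichletExpansion.summable {a : ℕ → ℂ} {f : ℂ → ℂ} {θ : ℝ}
    (h : IsDirichletExpansion a f θ) {s : ℂ} (hs : θ + 1 < s.re) : LSeriesSummable a s := by
  obtain ⟨t, ht, hts⟩ := exists_between (lt_sub_iff_add_lt.2 hs)
  have h1 := h.tendsto_sum_range (s := (t : ℂ)) (by simpa using ht)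
  have h2 := ((h1.comp (tendsto_add_atTop_nat 1)).sub h1)
  simp only [Function.comp_def, Finset.sum_range_succ, add_sub_cancel_left, sub_self] at h2
  obtain ⟨C, hC⟩ := (Metric.isBounded_range_of_tendsto _ h2).exists_norm_le
  refine LSeriesSummable_of_le_const_mul_rpow (x := t + 1) (by linarith) ⟨C, fun n hn => ?_⟩
  have h3 := hC _ ⟨n, rfl⟩
  rw [LSeries.norm_term_eq, if_neg hn, Complex.ofReal_re, div_le_iff₀ (by positivity)] at h3
  simpa using h3

lemma IsDirichletExpansion.LSeries_eq {a : ℕ → ℂ} {f : ℂ → ℂ} {θ : ℝ}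
    (h : IsDirichletExpansion a f θ) {s : ℂ} (hs : θ + 1 < s.re) : LSeries a s = f s :=
  tendsto_nhds_unique (h.summable hs).hasSum.tendsto_sum_nat
    (h.tendsto_sum_range (by linarith))

lemma IsDirichletExpansion.abscissa_lt_top {a : ℕ → ℂ} {f : ℂ → ℂ} {θ : ℝ}
    (h : IsDirichletExpansion a f θ) : LSeries.abscissaOfAbsConv a < ⊤ :=
  (h.summable (s := ((θ + 2 : ℝ) : ℂ)) (by simp)).abscissaOfAbsConv_le.trans_lt
    (EReal.coe_lt_top _)

/-- Uniqueness of Dirichlet coefficients, applied far to the right where all series converge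
absolutely. -/
lemma IsDirichletExpansion.mul_apply {a b c : ℕ → ℂ} {f g : ℂ → ℂ} {θ : ℝ}
    (ha : IsDirichletExpansion a f θ) (hb : IsDirichletExpansion b g θ)
    (hc : IsDirichletExpansion c (fun s => f s * g s) θ) {n : ℕ} (hn : n ≠ 0) :
    c n = LSeries.convolution a b n := by
  have htop : LSeries.abscissaOfAbsConv (LSeries.convolution a b) < ⊤ :=
    (LSeries.abscissaOfAbsConv_convolution_le a b).trans_lt
      (max_lt ha.abscissa_lt_top hb.abscissa_lt_top)
  refine LSeries.eq_of_LSeries_eventually_eq hc.abscissa_lt_top htop ?_ hn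
  filter_upwards [eventually_gt_atTop (θ + 1)] with x hx
  have hx' : θ + 1 < (x : ℂ).re := by simpa using hx
  rw [hc.LSeries_eq hx', LSeries_convolution' (ha.summable hx') (hb.summable hx'),
    ha.LSeries_eq hx', hb.LSeries_eq hx']

/-! ### Smooth parts of Dirichlet series and bounded powers. -/

section Smooth

/-- The part of a coefficient sequence that is supported on the `d`-smooth numbers. -/
def smoothPart (d : ℕ) (b : ℕ → ℂ) : ℕ → ℂ := (Nat.smoothNumbers d).indicator b

/-- A product is d-smooth exactly when both factors are. -/
lemma smoothPart_convolution (d : ℕ) (a b : ℕ → ℂ) :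
    smoothPart d (LSeries.convolution a b) =
      LSeries.convolution (smoothPart d a) (smoothPart d b) := by
  funext n
  rw [smoothPart, indicator_apply, LSeries.convolution_def, LSeries.convolution_def]
  split_ifs with h
  · refine Finset.sum_congr rfl fun p hp => ?_
    have hp' := (Nat.mem_divisorsAntidiagonal.1 hp).1
    rw [smoothPart, smoothPart, indicator_of_mem, indicator_of_mem]
    · exact Nat.mem_smoothNumbers_of_dvd h (hp' ▸ dvd_mul_left _ _)
    · exact Nat.mem_smoothNumbers_of_dvd h (hp' ▸ dvd_mul_right _ _)
  · refine (Finset.sum_eq_zero fun p hp => ?_).symm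
    have hp' := (Nat.mem_divisorsAntidiagonal.1 hp).1
    by_contra hne
    have h1 := mem_of_indicator_ne_zero (left_ne_zero_of_mul hne)
    have h2 := mem_of_indicator_ne_zero (right_ne_zero_of_mul hne)
    exact h (hp' ▸ Nat.mul_mem_smoothNumbers h1 h2)

/-- Only finitely many primes occur, so the Euler product is a finite product of convergent
geometric series for every σ > 0. -/
lemma summable_smoothNumbers_rpow (d : ℕ) {σ : ℝ} (hσ : 0 < σ) :
    Summable ((Nat.smoothNumbers d).indicator fun n : ℕ => (n : ℝ) ^ (-σ)) := by
  let f : ℕ →* ℝ :=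
    { toFun := fun n => (n : ℝ) ^ (-σ)
      map_one' := by simp
      map_mul' := fun m n => by
        rw [Nat.cast_mul, Real.mul_rpow (Nat.cast_nonneg _) (Nat.cast_nonneg _)] }
  have hf : ∀ {p : ℕ}, p.Prime → ‖f p‖ < 1 := fun {p} hp => by
    change ‖(p : ℝ) ^ (-σ)‖ < 1
    rw [Real.norm_of_nonneg (by positivity)]
    exact Real.rpow_lt_one_of_one_lt_of_neg (by exact_mod_cast hp.one_lt) (by linarith)
  have h := (EulerProduct.summable_and_hasSum_smoothNumbers_prod_primesBelow_geometric hf d).2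
  exact summable_subtype_iff_indicator.1 h.summable

/-- Point evaluations at points of `ℂ_+` are bounded on Dirichlet series supported on the
`d`-smooth numbers. -/
lemma exists_bound_smoothPart (d : ℕ) {s : ℂ} (hs : 0 < s.re) (A : ℝ) :
    ∃ M : ℝ, ∀ b : ℕ → ℂ, (∀ S : Finset ℕ, ∑ n ∈ S, ‖b n‖ ^ 2 * (n : ℝ) ^ (-s.re) ≤ A) →
      LSeriesSummable (smoothPart d b) s ∧ ‖LSeries (smoothPart d b) s‖ ≤ M := by
  set κ : ℕ → ℝ := (Nat.smoothNumbers d).indicator fun n : ℕ => (n : ℝ) ^ (-s.re) with hκ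
  have hκ0 : ∀ n, 0 ≤ κ n := fun n => indicator_nonneg (fun n _ => by positivity) n
  have hκs : Summable κ := summable_smoothNumbers_rpow d hs
  -- Cauchy–Schwarz with n^{-Re s} split evenly between the two factors; the bound does not depend
  -- on b.
  refine ⟨√A * √(∑' n, κ n), fun b hb => ?_⟩
  have hterm : ∀ n, ‖LSeries.term (smoothPart d b) s n‖ ≤
      (‖b n‖ * (n : ℝ) ^ (-s.re / 2)) * √(κ n) := by
    intro n
    rcases eq_or_ne n 0 with rfl | hn
    · rw [LSeries.term_zero, norm_zero]
      positivity
    have hn' : (0 : ℝ) < n := by positivity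
    rw [LSeries.norm_term_eq, if_neg hn, smoothPart, hκ]
    by_cases hm : n ∈ Nat.smoothNumbers d
    · rw [indicator_of_mem hm, indicator_of_mem hm, Real.sqrt_eq_rpow, ← Real.rpow_mul hn'.le,
        mul_assoc, ← Real.rpow_add hn', div_eq_mul_inv, ← Real.rpow_neg hn'.le]
      ring_nf
      rfl
    · rw [indicator_of_notMem hm, norm_zero, zero_div]
      positivity
  have hsum : ∀ S : Finset ℕ, ∑ n ∈ S, ‖LSeries.term (smoothPart d b) s n‖ ≤
      √A * √(∑' n, κ n) := by
    intro S
    refine (Finset.sum_le_sum fun n _ => hterm n).trans ?_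
    refine (Real.sum_mul_le_sqrt_mul_sqrt S _ _).trans ?_
    gcongr
    · refine (Finset.sum_le_sum fun n _ => le_of_eq ?_).trans (hb S)
      rw [mul_pow, ← Real.rpow_natCast ((n : ℝ) ^ _), ← Real.rpow_mul (Nat.cast_nonneg n)]
      congr 2
      push_cast
      ring
    · simp only [Real.sq_sqrt (hκ0 _)]
      exact hκs.sum_le_tsum S fun n _ => hκ0 n
  have hsm : Summable fun n => ‖LSeries.term (smoothPart d b) s n‖ :=
    summable_of_sum_le (fun n => norm_nonneg _) hsum
  exact ⟨hsm.of_norm, (norm_tsum_le_tsum_norm hsm).trans (hsm.tsum_le_of_sum_le hsum)⟩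

variable {B : ℕ → ℕ → ℂ} {g : ℂ → ℂ}

/-- The index starts at the first power, so `B 0` need not be identified. -/
lemma LSeries_smoothPart_pow
    (hB : ∀ k, IsDirichletExpansion (B k) (fun s => g s ^ k) (1 / 2)) (d : ℕ) {s : ℂ}
    (hsum : ∀ k, LSeriesSummable (smoothPart d (B k)) s) (k : ℕ) :
    LSeries (smoothPart d (B (k + 1))) s = LSeries (smoothPart d (B 1)) s ^ (k + 1) := by
  induction k with
  | zero => simp
  | succ k ih =>
    have h1 : ∀ {n : ℕ}, n ≠ 0 →
        smoothPart d (B (k + 1 + 1)) n = LSeries.convolution (smoothPart d (B (k + 1))) (smoothPart d (B 1)) n := by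
      intro n hn
      rw [← smoothPart_convolution, smoothPart, smoothPart, indicator_apply, indicator_apply]
      have hc : IsDirichletExpansion (B (k + 1 + 1)) (fun s => g s ^ (k + 1) * g s ^ 1) (1 / 2) := by
        simpa only [← pow_add] using hB (k + 1 + 1)
      rw [(hB (k + 1)).mul_apply (hB 1) hc hn]
    rw [LSeries_congr h1, LSeries_convolution' (hsum _) (hsum _), ih, ← pow_succ]

/-- If the powers of a Dirichlet series are bounded in `ℋ²` after every positive translation, then
its finite-prime parts are bounded by `1` on `ℂ_+`. -/
lemma norm_LSeries_smoothPart_le_one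
    (hB : ∀ k, IsDirichletExpansion (B k) (fun s => g s ^ k) (1 / 2))
    (hA : ∀ σ : ℝ, 0 < σ → ∃ A : ℝ, ∀ k, ∀ S : Finset ℕ,
      ∑ n ∈ S, ‖B k n‖ ^ 2 * (n : ℝ) ^ (-σ) ≤ A) (d : ℕ) {s : ℂ} (hs : 0 < s.re) :
    LSeriesSummable (smoothPart d (B 1)) s ∧ ‖LSeries (smoothPart d (B 1)) s‖ ≤ 1 := by
  obtain ⟨A, hA⟩ := hA s.re hs
  obtain ⟨M, hM⟩ := exists_bound_smoothPart d hs A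
  refine ⟨(hM _ (hA 1)).1, ?_⟩
  by_contra! hlt
  -- A modulus above 1 would make the powers exceed the bound `M`, which is common to all k.
  have ht := (tendsto_pow_atTop_atTop_of_one_lt hlt).comp (tendsto_add_atTop_nat 1)
  obtain ⟨k, hk⟩ := (ht.eventually_gt_atTop M).exists
  have h1 := (hM _ (hA (k + 1))).2
  rw [LSeries_smoothPart_pow hB d fun k => (hM _ (hA k)).1, norm_pow] at h1
  exact absurd h1 (not_le.2 hk)

lemma differentiableOn_LSeries {a : ℕ → ℂ} (h : ∀ s ∈ halfPlane 0, LSeriesSummable a s) :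
    DifferentiableOn ℂ (LSeries a) (halfPlane 0) := by
  refine (LSeries_differentiableOn a).mono fun s hs => ?_
  have hs' : 0 < s.re := hs
  have h1 : 0 < ((s.re / 2 : ℝ) : ℂ).re := by rw [Complex.ofReal_re]; linarith
  refine (h _ h1).abscissaOfAbsConv_le.trans_lt ?_
  rw [Complex.ofReal_re]
  exact_mod_cast half_lt_self hs'

/-- Every positive n < d is d-smooth, so the two series differ only in the tail from d on; the bound
is uniform in s. -/
lemma norm_LSeries_smoothPart_sub_le {b : ℕ → ℂ} {θ : ℝ} (hb : LSeriesSummable b θ) (d : ℕ)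
    {s : ℂ} (hs : θ ≤ s.re) :
    ‖LSeries (smoothPart d b) s - LSeries b s‖ ≤ ∑' n, ‖LSeries.term b θ (n + d)‖ := by
  have hbs : LSeriesSummable b s := hb.of_re_le_re (by simpa using hs)
  have hle : ∀ n, ‖smoothPart d b n‖ ≤ ‖b n‖ := fun n => norm_indicator_le_norm_self b n
  have hps : LSeriesSummable (smoothPart d b) s :=
    .of_norm_bounded hbs.norm fun n => LSeries.norm_term_le s (hle n)
  have hdiff : ∀ n, ‖LSeries.term (smoothPart d b) s n - LSeries.term b s n‖ ≤
      ‖LSeries.term b θ n‖ := by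
    intro n
    refine le_trans ?_ (LSeries.norm_term_le_of_re_le_re b (by simpa using hs) n)
    rw [LSeries.term_def, LSeries.term_def, smoothPart, indicator_apply]
    split_ifs
    · simp
    · rw [sub_self, norm_zero]
      exact norm_nonneg _
    · simp
  have hzero : ∀ n < d, LSeries.term (smoothPart d b) s n - LSeries.term b s n = 0 := by
    intro n hn
    rcases eq_or_ne n 0 with rfl | h0
    · simp
    · rw [LSeries.term_of_ne_zero h0, LSeries.term_of_ne_zero h0, smoothPart,
        indicator_of_mem (Nat.mem_smoothNumbers_of_lt (Nat.pos_of_ne_zero h0) hn), sub_self]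
  have hsub : Summable fun n => LSeries.term (smoothPart d b) s n - LSeries.term b s n :=
    Summable.sub hps hbs
  have heq : LSeries (smoothPart d b) s - LSeries b s =
      ∑' n, (LSeries.term (smoothPart d b) s (n + d) - LSeries.term b s (n + d)) := by
    have h1 := hsub.sum_add_tsum_nat_add d
    rw [Finset.sum_eq_zero fun n hn => hzero n (Finset.mem_range.1 hn), zero_add] at h1
    exact (Summable.tsum_sub hps hbs).symm.trans h1.symm
  have htail : Summable fun n => ‖LSeries.term b θ (n + d)‖ :=
    (summable_nat_add_iff (f := fun n => ‖LSeries.term b θ n‖) d).2 hb.norm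
  rw [heq]
  exact tsum_of_norm_bounded htail.hasSum fun n => hdiff (n + d)

end Smooth

/-! ### Passage to the limit over all primes. -/

section Limit

/-- A quantitative form of the three lines theorem on `ℂ_+`. -/
lemma norm_le_of_norm_le_right {f : ℂ → ℂ} (hf : DifferentiableOn ℂ f (halfPlane 0))
    (hb : ∀ s ∈ halfPlane 0, ‖f s‖ ≤ 2) {τ : ℝ} (hτ : τ ≤ 1)
    (hright : ∀ s : ℂ, 2 ≤ s.re → ‖f s‖ ≤ τ) {η : ℝ} (hη : 0 < η) {s : ℂ}
    (hs : 2 * η ≤ s.re) : ‖f s‖ ≤ 2 * τ ^ min 1 (η / 2) := by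
  have hτ0 : 0 ≤ τ := (norm_nonneg _).trans (hright 2 (by simp))
  have hexp : 0 < min 1 (η / 2) := by positivity
  rcases le_or_gt 2 s.re with h2 | h2
  · refine (hright s h2).trans ?_
    have h3 : τ ≤ τ ^ min 1 (η / 2) := by
      simpa using Real.rpow_le_rpow_of_exponent_ge' hτ0 hτ hexp.le (min_le_left 1 (η / 2))
    linarith [Real.rpow_nonneg hτ0 (min 1 (η / 2))]
  have hη2 : 0 < 2 - η := by linarith
  -- Affine change of variable carrying 0 ≤ Re z ≤ 1 onto η ≤ Re s ≤ 2.
  let f' : ℂ → ℂ := fun z => f (η + z * (2 - η : ℝ))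
  have hre : ∀ z : ℂ, (η + z * (2 - η : ℝ) : ℂ).re = η + z.re * (2 - η) := fun z => by simp
  have hmem : ∀ z ∈ Complex.HadamardThreeLines.verticalClosedStrip 0 1,
      (η + z * (2 - η : ℝ) : ℂ) ∈ halfPlane 0 := by
    intro z hz
    rw [mem_halfPlane, hre]
    have := mul_nonneg hz.1 hη2.le
    linarith
  have hd : DifferentiableOn ℂ f' (Complex.HadamardThreeLines.verticalClosedStrip 0 1) :=
    hf.comp (by fun_prop) hmem
  have hz : (s - η) / (2 - η : ℝ) ∈ Complex.HadamardThreeLines.verticalClosedStrip 0 1 := by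
    change ((s - η) / (2 - η : ℝ) : ℂ).re ∈ Icc 0 1
    rw [Complex.div_ofReal_re, Complex.sub_re, Complex.ofReal_re, mem_Icc, div_le_one hη2]
    exact ⟨div_nonneg (by linarith) hη2.le, by linarith⟩
  have hcl : closure (Complex.HadamardThreeLines.verticalStrip 0 1) =
      Complex.HadamardThreeLines.verticalClosedStrip 0 1 := by
    rw [Complex.HadamardThreeLines.verticalStrip, Complex.closure_preimage_re,
      closure_Ioo zero_ne_one, Complex.HadamardThreeLines.verticalClosedStrip]
  have key := Complex.HadamardThreeLines.norm_le_interp_of_mem_verticalClosedStrip₀₁' f'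
    (a := 2) (b := τ) hz (DifferentiableOn.diffContOnCl (by rwa [hcl]))
    ⟨2, by rintro _ ⟨z, hz, rfl⟩; exact hb _ (hmem z hz)⟩
    (fun z hz => hb _ (hmem z (by
      change z.re ∈ Icc 0 1
      rw [show z.re = 0 from hz]; simp)))
    (fun z hz => hright _ (by rw [hre, show z.re = 1 from hz]; linarith))
  have hval : f' ((s - η) / (2 - η : ℝ)) = f s := by
    have : ((2 - η : ℝ) : ℂ) ≠ 0 := by exact_mod_cast hη2.ne'
    simp only [f']
    congr 1
    field_simp
    ring
  have ht : ((s - η) / (2 - η : ℝ) : ℂ).re = (s.re - η) / (2 - η) := by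
    rw [Complex.div_ofReal_re, Complex.sub_re, Complex.ofReal_re]
  rw [hval, ht] at key
  refine key.trans ?_
  have ht0 : 0 ≤ (s.re - η) / (2 - η) := div_nonneg (by linarith) hη2.le
  -- The hypothesis 2η ≤ Re s bounds the interpolation exponent below independently of s; as τ ≤ 1,
  -- a smaller exponent weakens the estimate.
  have ht1 : min 1 (η / 2) ≤ (s.re - η) / (2 - η) := by
    refine (min_le_right _ _).trans ?_
    rw [div_le_div_iff₀ two_pos hη2]
    nlinarith
  gcongr ?_ * ?_
  · calc (2 : ℝ) ^ (1 - (s.re - η) / (2 - η)) ≤ 2 ^ (1 : ℝ) :=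
        Real.rpow_le_rpow_of_exponent_le one_le_two (by linarith)
      _ = 2 := Real.rpow_one 2
  · exact Real.rpow_le_rpow_of_exponent_ge' hτ0 hτ hexp.le ht1

/-- A sequence of analytic functions on `ℂ_+` bounded by `1` that converges uniformly on
`{Re s ≥ 2}` converges on `ℂ_+` to an analytic function bounded by `1`. -/
lemma exists_limit_of_bounded {f : ℕ → ℂ → ℂ} (hf : ∀ d, DifferentiableOn ℂ (f d) (halfPlane 0))
    (hb : ∀ d, ∀ s ∈ halfPlane 0, ‖f d s‖ ≤ 1) {g : ℂ → ℂ} {ρ : ℕ → ℝ}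
    (hρ : Tendsto ρ atTop (𝓝 0)) (hg : ∀ d, ∀ s : ℂ, 2 ≤ s.re → ‖f d s - g s‖ ≤ ρ d) :
    ∃ G : ℂ → ℂ, DifferentiableOn ℂ G (halfPlane 0) ∧ (∀ s ∈ halfPlane 0, ‖G s‖ ≤ 1) ∧
      ∀ s : ℂ, 2 ≤ s.re → G s = g s := by
  have hcauchy : ∀ η : ℝ, 0 < η → UniformCauchySeqOn f atTop (halfPlane (2 * η)) := by
    intro η hη
    rw [Metric.uniformCauchySeqOn_iff]
    intro ε hε
    have hexp : 0 < min 1 (η / 2) := by positivity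
    have hlim : Tendsto (fun τ : ℝ => 2 * τ ^ min 1 (η / 2)) (𝓝 0) (𝓝 0) := by
      have h := ((Real.continuousAt_rpow_const 0 _ (Or.inr hexp.le)).tendsto.const_mul 2)
      rwa [Real.zero_rpow hexp.ne', mul_zero] at h
    have h2 : Tendsto (fun p : ℕ × ℕ => ρ p.1 + ρ p.2) (atTop ×ˢ atTop) (𝓝 0) := by
      simpa using (hρ.comp tendsto_fst).add (hρ.comp tendsto_snd)
    have h3 := ((hlim.comp h2).eventually_lt_const hε).and (h2.eventually_le_const one_pos)
    rw [prod_atTop_atTop_eq, eventually_atTop] at h3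
    obtain ⟨⟨N, M⟩, h3⟩ := h3
    refine ⟨max N M, fun m hm n hn s hs => ?_⟩
    obtain ⟨h4, h5⟩ := h3 (m, n) ⟨(le_max_left _ _).trans hm, (le_max_right _ _).trans hn⟩
    rw [dist_eq_norm_sub]
    -- The difference of two members is at most 2 on ℂ_+ and at most ρ m + ρ n on Re s ≥ 2.
    refine lt_of_le_of_lt (norm_le_of_norm_le_right ((hf m).sub (hf n)) (fun z hz => ?_) h5
      (fun z hz => ?_) hη (le_of_lt hs)) h4
    · refine (norm_sub_le _ _).trans ?_
      linarith [hb m z hz, hb n z hz]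
    · rw [Pi.sub_apply, ← sub_sub_sub_cancel_right _ _ (g z)]
      exact (norm_sub_le _ _).trans (add_le_add (hg m z hz) (hg n z hz))
  have hcover : ∀ s ∈ halfPlane 0, ∃ η : ℝ, 0 < η ∧ s ∈ halfPlane (2 * η) := by
    intro s hs
    have hs' : 0 < s.re := hs
    exact ⟨s.re / 4, by linarith, by rw [mem_halfPlane]; linarith⟩
  have hex : ∀ s, ∃ z, s ∈ halfPlane 0 → Tendsto (fun d => f d s) atTop (𝓝 z) := by
    intro s
    by_cases hs : s ∈ halfPlane 0
    · obtain ⟨η, hη, hsη⟩ := hcover s hs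
      obtain ⟨z, hz⟩ := cauchySeq_tendsto_of_complete ((hcauchy η hη).cauchySeq hsη)
      exact ⟨z, fun _ => hz⟩
    · exact ⟨0, fun h => absurd h hs⟩
  choose G hG using hex
  refine ⟨G, ?_, fun s hs => ?_, fun s hs => ?_⟩
  · intro s hs
    obtain ⟨η, hη, hsη⟩ := hcover s hs
    have hsub : halfPlane (2 * η) ⊆ halfPlane 0 := fun z hz => by
      rw [mem_halfPlane] at hz ⊢
      linarith
    have hunif := (hcauchy η hη).tendstoUniformlyOn_of_tendsto fun z hz => hG z (hsub hz)
    have hdiff := hunif.tendstoLocallyUniformlyOn.differentiableOn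
      (Eventually.of_forall fun d => (hf d).mono hsub) (isOpen_halfPlane _)
    exact (hdiff.differentiableAt ((isOpen_halfPlane _).mem_nhds hsη)).differentiableWithinAt
  · exact le_of_tendsto (hG s hs).norm (Eventually.of_forall fun d => hb d s hs)
  · have hs0 : s ∈ halfPlane 0 := by rw [mem_halfPlane]; linarith
    refine tendsto_nhds_unique (hG s hs0) (tendsto_iff_norm_sub_tendsto_zero.2 ?_)
    exact squeeze_zero (fun _ => norm_nonneg _) (fun d => hg d s hs) hρ

/-- A Dirichlet series on `ℂ_{1/2}` whose powers are bounded in `ℋ²` after every positive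
translation extends to an analytic function on `ℂ_+` bounded by `1`. -/
lemma exists_bounded_extension_of_powers {B : ℕ → ℕ → ℂ} {g : ℂ → ℂ}
    (hg : DifferentiableOn ℂ g (halfPlane (1 / 2)))
    (hB : ∀ k, IsDirichletExpansion (B k) (fun s => g s ^ k) (1 / 2))
    (hA : ∀ σ : ℝ, 0 < σ → ∃ A : ℝ, ∀ k, ∀ S : Finset ℕ,
      ∑ n ∈ S, ‖B k n‖ ^ 2 * (n : ℝ) ^ (-σ) ≤ A) :
    ∃ G : ℂ → ℂ, DifferentiableOn ℂ G (halfPlane 0) ∧ (∀ s ∈ halfPlane 0, ‖G s‖ ≤ 1) ∧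
      EqOn G g (halfPlane (1 / 2)) := by
  have h1 : IsDirichletExpansion (B 1) g (1 / 2) := by simpa only [pow_one] using hB 1
  have hsum : LSeriesSummable (B 1) ((2 : ℝ) : ℂ) := h1.summable (by norm_num)
  have hρ : Tendsto (fun d => ∑' n, ‖LSeries.term (B 1) ((2 : ℝ) : ℂ) (n + d)‖) atTop (𝓝 0) :=
    tendsto_sum_nat_add fun n => ‖LSeries.term (B 1) ((2 : ℝ) : ℂ) n‖
  obtain ⟨G, hG, hG1, hGg⟩ := exists_limit_of_bounded
    (f := fun d => LSeries (smoothPart d (B 1)))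
    (fun d => differentiableOn_LSeries fun s hs => (norm_LSeries_smoothPart_le_one hB hA d hs).1)
    (fun d s hs => (norm_LSeries_smoothPart_le_one hB hA d hs).2) hρ
    (fun d s hs => norm_LSeries_smoothPart_sub_le hsum d hs)
  refine ⟨G, hG, hG1, ?_⟩
  have hsub : halfPlane (1 / 2) ⊆ halfPlane 0 := fun z hz => by
    rw [mem_halfPlane] at hz ⊢
    linarith
  -- Agreement near 3 spreads to ℂ_{1/2} by the identity theorem.
  refine ((hG.mono hsub).analyticOnNhd (isOpen_halfPlane _)).eqOn_of_preconnected_of_eventuallyEq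
    (hg.analyticOnNhd (isOpen_halfPlane _)) (isPreconnected_halfPlane _) (z₀ := 3)
    (by rw [mem_halfPlane]; norm_num) ?_
  filter_upwards [(isOpen_halfPlane 2).mem_nhds (x := 3) (by rw [mem_halfPlane]; norm_num)]
    with s hs
  rw [mem_halfPlane] at hs
  rw [hGg s hs.le, h1.LSeries_eq (by linarith)]

end Limit

/-! ### Weight estimates and extension of q^{-Φ}. -/

section Weight

variable {h : ℝ → ℝ}

lemma integrableOn_weight (hh : IsAdmissibleDensity h) {n : ℕ} (hn : n ≠ 0) :
    IntegrableOn (fun σ : ℝ => (n : ℝ) ^ (-2 * σ) * h σ) (Ioi 0) := by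
  have hn1 : (1 : ℝ) ≤ n := by exact_mod_cast Nat.one_le_iff_ne_zero.2 hn
  refine Integrable.bdd_mul (c := 1) hh.integrableOn ?_ ?_
  · refine Continuous.aestronglyMeasurable ?_
    exact Continuous.rpow continuous_const (by fun_prop) fun _ => Or.inl (by positivity)
  · filter_upwards [ae_restrict_mem measurableSet_Ioi] with σ hσ
    rw [Real.norm_of_nonneg (by positivity)]
    exact Real.rpow_le_one_of_one_le_of_nonpos hn1 (by linarith [mem_Ioi.1 hσ])

lemma weight_le_one (hh : IsAdmissibleDensity h) {n : ℕ} (hn : n ≠ 0) : weight h n ≤ 1 := by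
  have hn1 : (1 : ℝ) ≤ n := by exact_mod_cast Nat.one_le_iff_ne_zero.2 hn
  rw [← hh.integral_eq_one]
  refine setIntegral_mono_on (integrableOn_weight hh hn) hh.integrableOn measurableSet_Ioi ?_
  intro σ hσ
  refine mul_le_of_le_one_left (hh.nonneg σ hσ) ?_
  exact Real.rpow_le_one_of_one_le_of_nonpos hn1 (by linarith [mem_Ioi.1 hσ])

/-- Discard the integral beyond ε; on (0, ε) the power of n is at least its value at ε. -/
lemma rpow_mul_le_weight (hh : IsAdmissibleDensity h) {n : ℕ} (hn : n ≠ 0) (ε : ℝ) :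
    (n : ℝ) ^ (-2 * ε) * ∫ σ in Ioo (0 : ℝ) ε, h σ ≤ weight h n := by
  have hn1 : (1 : ℝ) ≤ n := by exact_mod_cast Nat.one_le_iff_ne_zero.2 hn
  have hint := integrableOn_weight hh hn
  rw [weight, ← integral_const_mul]
  refine le_trans (setIntegral_mono_on ((hh.integrableOn.mono_set Ioo_subset_Ioi_self).const_mul _)
    (hint.mono_set Ioo_subset_Ioi_self) measurableSet_Ioo fun σ hσ => ?_)
    (setIntegral_mono_set hint ?_ (Eventually.of_forall fun σ hσ => hσ.1))
  · refine mul_le_mul_of_nonneg_right ?_ (hh.nonneg σ hσ.1)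
    exact Real.rpow_le_rpow_of_exponent_le hn1 (by linarith [hσ.2])
  · filter_upwards [ae_restrict_mem measurableSet_Ioi] with σ hσ
    exact mul_nonneg (by positivity) (hh.nonneg σ hσ)

lemma exists_bound_of_normSq_le (hh : IsAdmissibleDensity h) (C : ℝ≥0) {σ : ℝ} (hσ : 0 < σ) :
    ∃ A : ℝ, ∀ b : ℕ → ℂ, normSq h b ≤ C → ∀ S : Finset ℕ,
      ∑ n ∈ S, ‖b n‖ ^ 2 * (n : ℝ) ^ (-σ) ≤ A := by
  -- The choice ε = σ/2 turns n^{-2ε} into n^{-σ}.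
  have hm := hh.zero_mem_support (σ / 2) (by linarith)
  set m := ∫ u in Ioo (0 : ℝ) (σ / 2), h u with hm_def
  refine ⟨C / m, fun b hb S => ?_⟩
  rw [le_div_iff₀ hm]
  have hsub : ∑ n ∈ S.subtype (0 < ·), ‖b n‖ₑ ^ 2 * ENNReal.ofReal (weight h n) ≤ C :=
    (ENNReal.sum_le_tsum (f := fun n : ℕ+ => ‖b n‖ₑ ^ 2 * ENNReal.ofReal (weight h n))
      (S.subtype (0 < ·))).trans hb
  have hterm : ∀ n : ℕ, 0 < n → ENNReal.ofReal (‖b n‖ ^ 2 * (n : ℝ) ^ (-σ) * m) ≤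
      ‖b n‖ₑ ^ 2 * ENNReal.ofReal (weight h n) := by
    intro n hn
    rw [mul_assoc, ENNReal.ofReal_mul (by positivity), ENNReal.ofReal_pow (norm_nonneg _),
      ofReal_norm]
    gcongr
    have h1 := rpow_mul_le_weight hh hn.ne' (σ / 2)
    rwa [show -2 * (σ / 2) = -σ by ring] at h1
  have hnonneg : ∀ n : ℕ, 0 ≤ ‖b n‖ ^ 2 * (n : ℝ) ^ (-σ) * m := fun n => by positivity
  have hzero : ∑ n ∈ S, ‖b n‖ ^ 2 * (n : ℝ) ^ (-σ) * m =
      ∑ n ∈ S.subtype (0 < ·), ‖b n‖ ^ 2 * ((n : ℕ) : ℝ) ^ (-σ) * m := by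
    rw [Finset.sum_subtype_eq_sum_filter (f := fun n : ℕ => ‖b n‖ ^ 2 * (n : ℝ) ^ (-σ) * m)]
    -- The index 0 contributes nothing, since 0 ^ (-σ) = 0 for real powers with σ ≠ 0.
    refine (Finset.sum_filter_of_ne fun n _ hne => ?_).symm
    by_contra hn
    have hn0 : n = 0 := by omega
    subst hn0
    simp [Real.zero_rpow (neg_ne_zero.2 hσ.ne')] at hne
  rw [Finset.sum_mul, hzero]
  refine (ENNReal.ofReal_le_ofReal_iff C.coe_nonneg).1 ?_
  rw [ENNReal.ofReal_sum_of_nonneg fun (n : {n : ℕ // 0 < n}) _ => hnonneg n, ENNReal.ofReal_coe_nnreal]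
  exact (Finset.sum_le_sum fun (n : {n : ℕ // 0 < n}) _ => hterm n n.2).trans hsub

lemma isBergmanElement_single (h : ℝ → ℝ) {m : ℕ} (hm : m ≠ 0) :
    IsBergmanElement h (Pi.single m 1) (fun s => (m : ℂ) ^ (-s)) := by
  refine ⟨?_, fun s _ => ?_⟩
  · rw [normSq, tsum_eq_single ⟨m, Nat.pos_of_ne_zero hm⟩]
    · simp
    · intro n hn
      have : (n : ℕ) ≠ m := fun h => hn (PNat.eq h)
      simp [Pi.single_eq_of_ne this]
  · refine tendsto_const_nhds.congr' ?_
    filter_upwards [eventually_ge_atTop m] with N hN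
    rw [Finset.sum_eq_single_of_mem m (Finset.mem_Icc.2 ⟨Nat.pos_of_ne_zero hm, hN⟩)]
    · simp
    · intro n _ hn
      simp [Pi.single_eq_of_ne hn]

lemma normSq_single_le (hh : IsAdmissibleDensity h) {m : ℕ} (hm : m ≠ 0) :
    normSq h (Pi.single m 1) ≤ 1 := by
  rw [normSq, tsum_eq_single ⟨m, Nat.pos_of_ne_zero hm⟩]
  · simpa using weight_le_one hh hm
  · intro n hn
    have : (n : ℕ) ≠ m := fun h => hn (PNat.eq h)
    simp [Pi.single_eq_of_ne this]

/-- If `Φ` is a symbol, then `q ^ (-Φ)` extends to an analytic function on `ℂ_+` bounded by `1`. -/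
lemma IsSymbol.exists_bounded_extension (hh : IsAdmissibleDensity h) {c₀ : ℕ} {Φ : ℂ → ℂ}
    (hΦ : IsSymbol h c₀ Φ) {q : ℕ} (hq : q ≠ 0) :
    ∃ G : ℂ → ℂ, DifferentiableOn ℂ G (halfPlane 0) ∧ (∀ s ∈ halfPlane 0, ‖G s‖ ≤ 1) ∧
      EqOn G (fun s => (q : ℂ) ^ (-Φ s)) (halfPlane (1 / 2)) := by
  obtain ⟨C, hC⟩ := hΦ.bounded
  have hqk : ∀ k, q ^ k ≠ 0 := fun k => pow_ne_zero k hq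
  choose B hB hBC using fun k => hC _ _ (isBergmanElement_single h (hqk k))
  refine exists_bounded_extension_of_powers (B := B) ?_ (fun k => ?_) (fun σ hσ => ?_)
  · exact hΦ.differentiableOn.neg.const_cpow (Or.inl (by exact_mod_cast hq))
  · have hfun : (fun s => ((q ^ k : ℕ) : ℂ) ^ (-s)) ∘ Φ = fun s => ((q : ℂ) ^ (-Φ s)) ^ k := by
      funext s
      rw [Function.comp_apply]
      induction k with
      | zero => simp
      | succ k ih => rw [pow_succ, Nat.cast_mul, Complex.natCast_mul_natCast_cpow, ih, pow_succ]
    exact hfun ▸ (hB k).2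
  -- All monomials have norm at most 1, so C² bounds the images for every k at once.
  · obtain ⟨A, hA⟩ := exists_bound_of_normSq_le hh (C ^ 2) hσ
    refine ⟨A, fun k => hA (B k) ((hBC k).trans ?_)⟩
    simpa using mul_le_mul_right (normSq_single_le hh (hqk k)) ((C : ℝ≥0∞) ^ 2)

end Weight

/-! ### Absence of zeros and analytic logarithms. -/

section Logarithm

/-- The order of vanishing is the residue of the logarithmic derivative. -/
lemma tendsto_sub_mul_deriv_div {f : ℂ → ℂ} {z : ℂ} (hf : AnalyticAt ℂ f z)
    (h : analyticOrderAt f z ≠ ⊤) :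
    (∀ᶠ w in 𝓝[≠] z, f w ≠ 0) ∧
      Tendsto (fun w => (w - z) * deriv f w / f w) (𝓝[≠] z) (𝓝 (analyticOrderNatAt f z)) := by
  obtain ⟨u, hu, hu0, hfu⟩ := hf.analyticOrderAt_ne_top.1 h
  set m := analyticOrderNatAt f z
  have hune : ∀ᶠ w in 𝓝 z, u w ≠ 0 := hu.continuousAt.eventually_ne hu0
  refine ⟨?_, ?_⟩
  · filter_upwards [nhdsWithin_le_nhds hfu, nhdsWithin_le_nhds hune, self_mem_nhdsWithin]
      with w h1 h2 h3
    rw [h1]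
    exact smul_ne_zero (pow_ne_zero _ (sub_ne_zero.2 h3)) h2
  · have hlim : Tendsto (fun w => (m : ℂ) + (w - z) * deriv u w / u w) (𝓝[≠] z) (𝓝 m) := by
      have h1 : ContinuousAt (fun w => (m : ℂ) + (w - z) * deriv u w / u w) z :=
        continuousAt_const.add
          (((continuousAt_id.sub continuousAt_const).mul hu.deriv.continuousAt).div
            hu.continuousAt hu0)
      simpa using h1.tendsto.mono_left (nhdsWithin_le_nhds (s := {z}ᶜ))
    refine hlim.congr' ?_
    filter_upwards [nhdsWithin_le_nhds hfu.eventuallyEq_nhds, nhdsWithin_le_nhds hune,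
      nhdsWithin_le_nhds hu.eventually_analyticAt, self_mem_nhdsWithin] with w h1 h2 h3 h4
    have h5 : w - z ≠ 0 := sub_ne_zero.2 h4
    have h6 : HasDerivAt (fun y => (y - z) ^ m • u y)
        (((m : ℂ) * (w - z) ^ (m - 1) * 1) * u w + (w - z) ^ m * deriv u w) w :=
      (((hasDerivAt_id w).sub_const z).pow m).mul h3.differentiableAt.hasDerivAt
    rw [h1.deriv_eq, h6.deriv, h1.eq_of_nhds, smul_eq_mul]
    rcases Nat.eq_zero_or_pos m with hm | hm
    · rw [hm]
      simp
    · obtain ⟨k, hk⟩ := Nat.exists_eq_add_of_lt hm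
      rw [hk]
      simp only [zero_add, Nat.add_sub_cancel]
      field_simp
      ring

/-- Proportional logarithmic derivatives force proportional orders of vanishing. -/
lemma mul_analyticOrderNatAt_eq {f g : ℂ → ℂ} {z α β : ℂ} (hf : AnalyticAt ℂ f z)
    (hg : AnalyticAt ℂ g z) (hf' : analyticOrderAt f z ≠ ⊤) (hg' : analyticOrderAt g z ≠ ⊤)
    (h : ∀ᶠ w in 𝓝 z, α * (deriv f w * g w) = β * (deriv g w * f w)) :
    α * analyticOrderNatAt f z = β * analyticOrderNatAt g z := by
  obtain ⟨hf0, hfl⟩ := tendsto_sub_mul_deriv_div hf hf'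
  obtain ⟨hg0, hgl⟩ := tendsto_sub_mul_deriv_div hg hg'
  refine tendsto_nhds_unique (hfl.const_mul α) ((hgl.const_mul β).congr' ?_)
  filter_upwards [hf0, hg0, nhdsWithin_le_nhds h] with w h1 h2 h3
  field_simp
  linear_combination (-(w - z)) * h3

/-- Exponentiating gives 3^m = 2^n; parity forces n = 0, then m = 0. -/
lemma eq_zero_of_log_three_mul_eq {m n : ℕ} (h : Real.log 3 * m = Real.log 2 * n) : m = 0 := by
  have h1 : Real.log ((3 : ℝ) ^ m) = Real.log ((2 : ℝ) ^ n) := by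
    rw [Real.log_pow, Real.log_pow]
    linarith
  have h2 : (3 : ℝ) ^ m = 2 ^ n :=
    Real.log_injOn_pos (mem_Ioi.2 (by positivity)) (mem_Ioi.2 (by positivity)) h1
  have h3 : 3 ^ m = 2 ^ n := by exact_mod_cast h2
  have hodd : Odd (2 ^ n) := h3 ▸ Odd.pow (by decide)
  have hn : n = 0 := by
    by_contra hn
    exact (Nat.not_even_iff_odd.2 hodd) ((by decide : Even 2).pow_of_ne_zero hn)
  rw [hn, pow_zero] at h3
  by_contra hm
  exact absurd h3 (Nat.one_lt_pow hm (by norm_num)).ne'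

lemma halfPlane_half_subset : halfPlane (1 / 2) ⊆ halfPlane 0 := fun z hz => by
  rw [mem_halfPlane] at hz ⊢
  linarith

lemma three_mem_halfPlane : (3 : ℂ) ∈ halfPlane (1 / 2) := by
  rw [mem_halfPlane]
  norm_num

lemma deriv_eq_of_eqOn_cpow_neg {Φ : ℂ → ℂ} (hΦ : DifferentiableOn ℂ Φ (halfPlane (1 / 2)))
    {q : ℕ} (hq : q ≠ 0) {G : ℂ → ℂ}
    (hG : EqOn G (fun s => (q : ℂ) ^ (-Φ s)) (halfPlane (1 / 2))) {s : ℂ}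
    (hs : s ∈ halfPlane (1 / 2)) :
    deriv G s = -(G s * (Real.log q * deriv Φ s)) := by
  have hU := (isOpen_halfPlane (1 / 2)).mem_nhds hs
  have h1 : HasDerivAt (fun w => (q : ℂ) ^ (-Φ w)) _ s :=
    ((hΦ.differentiableAt hU).hasDerivAt.neg).const_cpow (Or.inl (by exact_mod_cast hq))
  have h2 : G =ᶠ[𝓝 s] fun s => (q : ℂ) ^ (-Φ s) := by
    filter_upwards [hU] with w hw using hG hw
  rw [h2.deriv_eq, h1.deriv, hG hs, Complex.natCast_log, Pi.neg_apply]
  ring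

/-- If `2 ^ (-Φ)` and `3 ^ (-Φ)` extend analytically to `ℂ_+`, then the extension of `2 ^ (-Φ)` has
no zeros. -/
lemma ne_zero_of_extensions {Φ G₂ G₃ : ℂ → ℂ} (hΦ : DifferentiableOn ℂ Φ (halfPlane (1 / 2)))
    (h₂ : DifferentiableOn ℂ G₂ (halfPlane 0)) (h₃ : DifferentiableOn ℂ G₃ (halfPlane 0))
    (e₂ : EqOn G₂ (fun s => ((2 : ℕ) : ℂ) ^ (-Φ s)) (halfPlane (1 / 2)))
    (e₃ : EqOn G₃ (fun s => ((3 : ℕ) : ℂ) ^ (-Φ s)) (halfPlane (1 / 2))) {s : ℂ}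
    (hs : s ∈ halfPlane 0) : G₂ s ≠ 0 := by
  have hU := isOpen_halfPlane 0
  have a₂ := h₂.analyticOnNhd hU
  have a₃ := h₃.analyticOnNhd hU
  have hthree := halfPlane_half_subset three_mem_halfPlane
  have order_ne_top : ∀ {G : ℂ → ℂ} {q : ℕ}, q ≠ 0 → AnalyticOnNhd ℂ G (halfPlane 0) →
      EqOn G (fun s => (q : ℂ) ^ (-Φ s)) (halfPlane (1 / 2)) → analyticOrderAt G s ≠ ⊤ := by
    intro G q hq hG hGe
    refine hG.analyticOrderAt_ne_top_of_isPreconnected (isPreconnected_halfPlane 0) hthree hs ?_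
    have h0 : G 3 ≠ 0 := by
      rw [hGe three_mem_halfPlane]
      simp [Complex.cpow_eq_zero_iff, hq]
    rw [(hG 3 hthree).analyticOrderAt_eq_zero.2 h0]
    exact ENat.zero_ne_top
  -- On ℂ_{1/2} both sides equal -log 2 · log 3 · Φ' · G₂ · G₃; the identity theorem carries the
  -- relation to ℂ_+.
  have hrel : EqOn (fun w => (Real.log 3 : ℂ) * (deriv G₂ w * G₃ w))
      (fun w => (Real.log 2 : ℂ) * (deriv G₃ w * G₂ w)) (halfPlane 0) := by
    refine AnalyticOnNhd.eqOn_of_preconnected_of_eventuallyEq (z₀ := 3)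
      (analyticOnNhd_const.mul (a₂.deriv.mul a₃)) (analyticOnNhd_const.mul (a₃.deriv.mul a₂))
      (isPreconnected_halfPlane 0) hthree ?_
    filter_upwards [(isOpen_halfPlane (1 / 2)).mem_nhds three_mem_halfPlane] with w hw
    rw [deriv_eq_of_eqOn_cpow_neg hΦ two_ne_zero e₂ hw, deriv_eq_of_eqOn_cpow_neg hΦ three_ne_zero e₃ hw]
    push_cast
    ring
  have hord := mul_analyticOrderNatAt_eq (a₂ s hs) (a₃ s hs) (order_ne_top two_ne_zero a₂ e₂)
    (order_ne_top three_ne_zero a₃ e₃)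
    (by filter_upwards [hU.mem_nhds hs] with w hw using hrel hw)
  have hm : analyticOrderNatAt G₂ s = 0 := eq_zero_of_log_three_mul_eq (by exact_mod_cast hord)
  refine (a₂ s hs).analyticOrderAt_eq_zero.1 ?_
  rw [← Nat.cast_analyticOrderNatAt (order_ne_top two_ne_zero a₂ e₂), hm, Nat.cast_zero]

/-- A zero-free analytic function on the unit disc has an analytic logarithm. -/
lemma exists_log_of_ne_zero_ball {H : ℂ → ℂ} (hH : DifferentiableOn ℂ H (Metric.ball 0 1))
    (h0 : ∀ z ∈ Metric.ball (0 : ℂ) 1, H z ≠ 0) :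
    ∃ L : ℂ → ℂ, DifferentiableOn ℂ L (Metric.ball 0 1) ∧
      ∀ z ∈ Metric.ball (0 : ℂ) 1, Complex.exp (L z) = H z := by
  have hmem : (0 : ℂ) ∈ Metric.ball (0 : ℂ) 1 := Metric.mem_ball_self one_pos
  have hopen : IsOpen (Metric.ball (0 : ℂ) 1) := Metric.isOpen_ball
  -- L is the primitive of H'/H normalised at 0, so H · exp(-L) is constant and equals 1.
  obtain ⟨L, hL0, hL⟩ := Complex.IsExactOn.with_val_at
    (((hH.deriv hopen).div hH h0).isExactOn_ball) 0 (Complex.log (H 0))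
  have hLd : DifferentiableOn ℂ L (Metric.ball 0 1) := fun z hz =>
    (hL z hz).differentiableAt.differentiableWithinAt
  have hder : ∀ z ∈ Metric.ball (0 : ℂ) 1,
      HasDerivAt (fun z => H z * Complex.exp (-L z)) 0 z := by
    intro z hz
    have h1 : HasDerivAt (fun z => H z * Complex.exp (-L z)) _ z :=
      (hH.differentiableAt (hopen.mem_nhds hz)).hasDerivAt.mul ((hL z hz).neg.cexp)
    refine h1.congr_deriv ?_
    have := h0 z hz
    rw [Pi.div_apply, Pi.neg_apply]
    field_simp
    ring
  refine ⟨L, hLd, fun z hz => ?_⟩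
  have hconst := hopen.is_const_of_deriv_eq_zero (convex_ball (0 : ℂ) 1).isPreconnected
    (fun z hz => (hder z hz).differentiableAt.differentiableWithinAt)
    (fun z hz => (hder z hz).deriv) hz hmem
  simp only [hL0] at hconst
  rw [Complex.exp_neg, Complex.exp_neg, Complex.exp_log (h0 0 hmem),
    mul_inv_cancel₀ (h0 0 hmem)] at hconst
  rw [mul_inv_eq_one₀ (Complex.exp_ne_zero _)] at hconst
  exact hconst.symm

lemma exists_log_of_ne_zero {G : ℂ → ℂ} (hG : DifferentiableOn ℂ G (halfPlane 0))
    (h0 : ∀ s ∈ halfPlane 0, G s ≠ 0) :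
    ∃ L : ℂ → ℂ, DifferentiableOn ℂ L (halfPlane 0) ∧
      ∀ s ∈ halfPlane 0, Complex.exp (L s) = G s := by
  have h1 : (1 : ℂ) ∈ halfPlane 0 := by simp [mem_halfPlane]
  obtain ⟨L, hL, hexp⟩ := exists_log_of_ne_zero_ball
    (hG.comp (differentiableOn_cayley 1) fun z hz => cayley_mem h1 hz)
    (fun z hz => h0 _ (cayley_mem h1 hz))
  refine ⟨fun s => L ((s - 1) / (s + conj 1)), ?_, fun s hs => ?_⟩
  · refine hL.comp ?_ fun s hs => cayleyInv_mem h1 hs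
    exact (differentiableOn_id.sub_const _).div (differentiableOn_id.add_const _)
      fun s hs => add_conj_ne_zero hs h1
  · rw [hexp _ (cayleyInv_mem h1 hs), Function.comp_apply, cayley_cayleyInv h1 hs]

end Logarithm

/-! ### The extended symbol and its growth. -/

section Extension

variable {h : ℝ → ℝ} {c₀ : ℕ} {Φ : ℂ → ℂ}

/-- A symbol extends to an analytic self-map of `ℂ_+`. -/
lemma IsSymbol.exists_extension (hh : IsAdmissibleDensity h) (hΦ : IsSymbol h c₀ Φ) :
    ∃ Ψ : ℂ → ℂ, IsAnalyticExtension Φ Ψ ∧ MapsTo Ψ (halfPlane 0) (halfPlane 0) := by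
  obtain ⟨G₂, h₂, b₂, e₂⟩ := hΦ.exists_bounded_extension hh two_ne_zero
  obtain ⟨G₃, h₃, -, e₃⟩ := hΦ.exists_bounded_extension hh three_ne_zero
  have hne : ∀ s ∈ halfPlane 0, G₂ s ≠ 0 := fun s hs =>
    ne_zero_of_extensions hΦ.differentiableOn h₂ h₃ e₂ e₃ hs
  obtain ⟨L, hL, hexp⟩ := exists_log_of_ne_zero h₂ hne
  have hlog : 0 < Real.log 2 := Real.log_pos one_lt_two
  have hlogC : (Real.log 2 : ℂ) ≠ 0 := by exact_mod_cast hlog.ne'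
  have hD : ∀ s ∈ halfPlane (1 / 2), Complex.exp (L s + Real.log 2 * Φ s) = 1 := by
    intro s hs
    rw [Complex.exp_add, hexp s (halfPlane_half_subset hs), e₂ hs]
    simp only
    rw [Complex.cpow_def_of_ne_zero (by norm_num), ← Complex.exp_add, ← Complex.natCast_log,
      ← Complex.exp_zero]
    congr 1
    push_cast
    ring
  have hDd : DifferentiableOn ℂ (fun s => L s + Real.log 2 * Φ s) (halfPlane (1 / 2)) :=
    (hL.mono halfPlane_half_subset).add (hΦ.differentiableOn.const_mul _)
  have hDderiv : EqOn (deriv fun s => L s + Real.log 2 * Φ s) 0 (halfPlane (1 / 2)) := by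
    intro s hs
    have hU := (isOpen_halfPlane (1 / 2)).mem_nhds hs
    have h1 := (hDd.differentiableAt hU).hasDerivAt.cexp
    have h2 : (fun s => Complex.exp (L s + Real.log 2 * Φ s)) =ᶠ[𝓝 s] fun _ => 1 := by
      filter_upwards [hU] with w hw using hD w hw
    have h3 := h1.deriv
    rw [h2.deriv_eq, deriv_const, hD s hs, one_mul] at h3
    exact h3.symm
  obtain ⟨κ, hκ⟩ := (isOpen_halfPlane (1 / 2)).exists_is_const_of_deriv_eq_zero
    (isPreconnected_halfPlane _) hDd hDderiv
  -- The logarithm L and -log 2 · Φ differ by an imaginary constant, which leaves Re Ψ determined by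
  -- |G₂|.
  have hκre : κ.re = 0 := by
    have h1 := hD 3 three_mem_halfPlane
    rw [hκ 3 three_mem_halfPlane] at h1
    have h2 := congrArg norm h1
    rw [Complex.norm_exp, norm_one] at h2
    exact Real.exp_eq_one_iff _ |>.1 h2
  refine ⟨fun s => (κ - L s) / Real.log 2, ⟨(hL.const_sub κ).div_const _, fun s hs => ?_⟩, ?_⟩
  · simp only
    rw [← hκ s hs, add_sub_cancel_left, mul_div_cancel_left₀ _ hlogC]
  · intro s hs
    -- Equality would make |G₂| constantly 1 by the maximum principle, contradicting Re Φ(3) > 1/2.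
    have hlt : ‖G₂ s‖ < 1 := by
      refine lt_of_le_of_ne (b₂ s hs) fun heq => ?_
      have hmax := Complex.norm_eqOn_of_isPreconnected_of_isMaxOn (isPreconnected_halfPlane 0)
        (isOpen_halfPlane 0) h₂ hs (fun w hw => (b₂ w hw).trans heq.ge)
        (halfPlane_half_subset three_mem_halfPlane)
      have h3 : (1 / 2 : ℝ) < (Φ 3).re := hΦ.mapsTo three_mem_halfPlane
      simp only [Function.comp_apply, Function.const_apply, heq] at hmax
      rw [e₂ three_mem_halfPlane, Complex.norm_natCast_cpow_of_pos two_pos] at hmax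
      refine absurd hmax (Real.rpow_lt_one_of_one_lt_of_neg (by norm_num) ?_).ne
      rw [Complex.neg_re]
      linarith
    rw [← hexp s hs, Complex.norm_exp, Real.exp_lt_one_iff] at hlt
    rw [mem_halfPlane, Complex.div_ofReal_re, Complex.sub_re, hκre]
    exact div_pos (by linarith) hlog

/-- Along the reals φ tends to its first coefficient, so only c₀s survives division by x. -/
lemma IsSymbol.tendsto_div (hΦ : IsSymbol h c₀ Φ) :
    Tendsto (fun x : ℝ => Φ x / x) atTop (𝓝 ((c₀ : ℝ) : ℂ)) := by
  obtain ⟨φ, ⟨a, θ, ha⟩, hform⟩ := hΦ.form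
  have h1 : Tendsto (fun x : ℝ => φ x) atTop (𝓝 (a 1)) := by
    refine (LSeries.tendsto_atTop ha.abscissa_lt_top).congr' ?_
    filter_upwards [eventually_gt_atTop (θ + 1)] with x hx
    exact ha.LSeries_eq (by simpa using hx)
  have h2 : Tendsto (fun x : ℝ => φ x * ((x⁻¹ : ℝ) : ℂ)) atTop (𝓝 0) := by
    have h := (Complex.continuous_ofReal.tendsto 0).comp tendsto_inv_atTop_zero
    simpa using h1.mul h
  have h3 := h2.const_add (c₀ : ℂ)
  rw [add_zero] at h3
  rw [Complex.ofReal_natCast]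
  refine h3.congr' ?_
  filter_upwards [eventually_gt_atTop (1 / 2)] with x hx
  have hx0 : (x : ℂ) ≠ 0 := by
    exact_mod_cast (show (0 : ℝ) < x by linarith).ne'
  rw [hform x (by simpa [mem_halfPlane] using hx)]
  push_cast
  field_simp

end Extension

/-! ### Counting inequality and integration against h. -/

section Counting

variable {Ψ : ℂ → ℂ} {c : ℝ}

lemma mul_re_le_re (hΨ : DifferentiableOn ℂ Ψ (halfPlane 0))
    (hmaps : MapsTo Ψ (halfPlane 0) (halfPlane 0)) (hc : 0 < c)
    (hlim : Tendsto (fun x : ℝ => Ψ x / x) atTop (𝓝 c)) {a : ℂ} (ha : a ∈ halfPlane 0) :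
    c * a.re ≤ (Ψ a).re := by
  simpa using mul_sum_re_le hΨ hmaps hc hlim {a} (hmaps ha) (by simpa using ha)

lemma mul_sum_max_le (hΨ : DifferentiableOn ℂ Ψ (halfPlane 0))
    (hmaps : MapsTo Ψ (halfPlane 0) (halfPlane 0)) (hc : 1 ≤ c)
    (hlim : Tendsto (fun x : ℝ => Ψ x / x) atTop (𝓝 c)) (T : Finset ℂ) {w : ℂ}
    (hT : ∀ a ∈ T, a ∈ halfPlane 0 ∧ Ψ a = w) {u : ℝ} (hu : 0 ≤ u) :
    c * ∑ a ∈ T, max (a.re - u) 0 ≤ max (w.re - u) 0 := by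
  classical
  have hc0 : 0 < c := one_pos.trans_le hc
  have hshift : ∀ s ∈ halfPlane 0, s + u ∈ halfPlane 0 := fun s hs => by
    rw [mem_halfPlane] at hs ⊢
    simpa using by linarith
  -- Here c ≥ 1 enters: Ψ does not decrease real parts, so the shifted map below preserves ℂ_+.
  have hre : ∀ s ∈ halfPlane 0, s.re ≤ (Ψ s).re := fun s hs =>
    (le_mul_of_one_le_left (le_of_lt hs) hc).trans (mul_re_le_re hΨ hmaps hc0 hlim hs)
  rcases (T.filter fun a => u < a.re).eq_empty_or_nonempty with hempty | ⟨b, hb⟩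
  · have h0 : ∑ a ∈ T, max (a.re - u) 0 = 0 := by
      refine Finset.sum_eq_zero fun a ha => max_eq_right ?_
      have := Finset.filter_eq_empty_iff.1 hempty ha
      linarith
    rw [h0, mul_zero]
    exact le_max_right _ _
  · obtain ⟨hbT, hbu⟩ := Finset.mem_filter.1 hb
    have hw : u < w.re := hbu.trans_le ((hT b hbT).2 ▸ hre b (hT b hbT).1)
    have hF : DifferentiableOn ℂ (fun s => Ψ (s + u) - u) (halfPlane 0) :=
      (hΨ.comp (by fun_prop) hshift).sub_const _
    have hFm : MapsTo (fun s => Ψ (s + u) - u) (halfPlane 0) (halfPlane 0) := by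
      intro s hs
      have h1 := hre _ (hshift s hs)
      rw [mem_halfPlane] at hs ⊢
      simp only [Complex.add_re, Complex.ofReal_re, Complex.sub_re] at h1 ⊢
      linarith
    have hFl : Tendsto (fun x : ℝ => (Ψ (x + u) - u) / x) atTop (𝓝 c) := by
      have h1 := hlim.comp (tendsto_atTop_add_const_right atTop u tendsto_id)
      have h2 : Tendsto (fun x : ℝ => (u : ℂ) * ((x⁻¹ : ℝ) : ℂ)) atTop (𝓝 0) := by
        have h := (Complex.continuous_ofReal.tendsto 0).comp tendsto_inv_atTop_zero
        simpa using h.const_mul (u : ℂ)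
      -- (Ψ(x+u) - u)/x = Ψ(x+u)/(x+u) · (1 + u/x) - u/x.
      have h3 := (h1.mul (h2.const_add 1)).sub h2
      rw [add_zero, mul_one, sub_zero] at h3
      refine h3.congr' ?_
      filter_upwards [eventually_gt_atTop 0] with x hx
      have hx0 : (x : ℂ) ≠ 0 := by exact_mod_cast hx.ne'
      have hxu : (x : ℂ) + u ≠ 0 := by exact_mod_cast (show (0 : ℝ) < x + u by linarith).ne'
      simp only [Function.comp_apply, id_eq]
      push_cast
      field_simp
    have key := mul_sum_re_le hF hFm hc0 hFl ((T.filter fun a => u < a.re).image (· - (u : ℂ)))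
      (w := w - u) (by simpa [mem_halfPlane] using hw) (fun z hz => by
        obtain ⟨a, ha, rfl⟩ := Finset.mem_image.1 hz
        obtain ⟨haT, hau⟩ := Finset.mem_filter.1 ha
        refine ⟨by simpa [mem_halfPlane] using hau, ?_⟩
        simp only [sub_add_cancel, (hT a haT).2])
    rw [Finset.sum_image fun x _ y _ hxy => sub_left_injective hxy] at key
    have hsum : ∑ a ∈ T, max (a.re - u) 0 =
        ∑ a ∈ T.filter fun a => u < a.re, (a - (u : ℂ)).re := by
      rw [Finset.sum_filter]
      refine Finset.sum_congr rfl fun a _ => ?_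
      split_ifs with hau
      · simpa using hau.le
      · exact max_eq_right (by linarith)
    rw [hsum]
    refine key.trans (le_trans (le_of_eq ?_) (le_max_left _ _))
    simp

variable {h : ℝ → ℝ}

lemma integrableOn_max_mul (hh : IsAdmissibleDensity h) (σ : ℝ) :
    IntegrableOn (fun u => max (σ - u) 0 * h u) (Ioi 0) := by
  refine Integrable.bdd_mul (c := |σ|) hh.integrableOn ?_ ?_
  · exact Continuous.aestronglyMeasurable (by fun_prop)
  · filter_upwards [ae_restrict_mem measurableSet_Ioi] with u hu
    rw [Real.norm_of_nonneg (le_max_right _ _)]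
    refine max_le ?_ (abs_nonneg σ)
    linarith [le_abs_self σ, mem_Ioi.1 hu]

/-- The positive part moves the dependence on σ from the domain into the integrand, so all preimages
share one integral. -/
lemma betaFun_eq {σ : ℝ} (hσ : 0 ≤ σ) :
    betaFun h σ = ∫ u in Ioi (0 : ℝ), max (σ - u) 0 * h u := by
  rw [betaFun, intervalIntegral.integral_of_le hσ,
    setIntegral_eq_of_subset_of_forall_sdiff_eq_zero measurableSet_Ioi Ioc_subset_Ioi_self]
  · refine setIntegral_congr_fun measurableSet_Ioc fun u hu => ?_
    rw [max_eq_left (by linarith [hu.2])]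
  · intro u hu
    have h1 : σ < u := by
      by_contra hle
      exact hu.2 ⟨hu.1, not_lt.1 hle⟩
    rw [max_eq_right (by linarith), zero_mul]

lemma betaFun_nonneg (hh : IsAdmissibleDensity h) {σ : ℝ} (hσ : 0 ≤ σ) : 0 ≤ betaFun h σ := by
  rw [betaFun_eq hσ]
  exact setIntegral_nonneg measurableSet_Ioi fun u hu =>
    mul_nonneg (le_max_right _ _) (hh.nonneg u hu)

lemma sum_betaFun_le (hh : IsAdmissibleDensity h) (hΨ : DifferentiableOn ℂ Ψ (halfPlane 0))
    (hmaps : MapsTo Ψ (halfPlane 0) (halfPlane 0)) (hc : 1 ≤ c)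
    (hlim : Tendsto (fun x : ℝ => Ψ x / x) atTop (𝓝 c)) (T : Finset ℂ) {w : ℂ}
    (hw : w ∈ halfPlane 0) (hT : ∀ a ∈ T, a ∈ halfPlane 0 ∧ Ψ a = w) :
    ∑ a ∈ T, betaFun h a.re ≤ betaFun h w.re / c := by
  have hc0 : 0 < c := one_pos.trans_le hc
  have hint : ∀ a : ℂ, Integrable (fun u => max (a.re - u) 0 * h u) (volume.restrict (Ioi 0)) :=
    fun a => integrableOn_max_mul hh a.re
  rw [le_div_iff₀' hc0, betaFun_eq (le_of_lt hw),
    Finset.sum_congr rfl fun a ha => betaFun_eq (le_of_lt (hT a ha).1),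
    ← integral_finsetSum _ fun a _ => hint a, ← integral_const_mul]
  refine setIntegral_mono_on
    ((integrable_finsetSum _ fun a _ => hint a).const_mul c)
    (hint w) measurableSet_Ioi fun u hu => ?_
  rw [← Finset.sum_mul, ← mul_assoc]
  exact mul_le_mul_of_nonneg_right
    (mul_sum_max_le hΨ hmaps hc hlim T hT (le_of_lt hu)) (hh.nonneg u hu)

end Counting

end DirichletBergman

end

theorem mainTheorem9 (h : ℝ → ℝ) (hh : DirichletBergman.IsAdmissibleDensity h)
    (c₀ : ℕ) (hc₀ : 1 ≤ c₀) (Φ : ℂ → ℂ) (hΦ : DirichletBergman.IsSymbol h c₀ Φ) :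
    ∃ Ψ : ℂ → ℂ, DirichletBergman.IsAnalyticExtension Φ Ψ ∧
      ∀ s ∈ DirichletBergman.halfPlane 0,
        DirichletBergman.nevanlinna (DirichletBergman.betaFun h) Ψ s ≤
          ENNReal.ofReal (DirichletBergman.betaFun h s.re / c₀) := by
  obtain ⟨Ψ, hext, hmaps⟩ := hΦ.exists_extension hh
  refine ⟨Ψ, hext, fun s hs => ?_⟩
  have hlim : Tendsto (fun x : ℝ => Ψ x / x) atTop (𝓝 ((c₀ : ℝ) : ℂ)) := by
    refine hΦ.tendsto_div.congr' ?_
    filter_upwards [eventually_gt_atTop (1 / 2)] with x hx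
    rw [hext.2 (by simpa [DirichletBergman.mem_halfPlane] using hx)]
  -- An extended nonnegative sum is the supremum of its finite partial sums, so finite sets of
  -- preimages suffice.
  rw [DirichletBergman.nevanlinna, ENNReal.tsum_eq_iSup_sum]
  refine iSup_le fun S => ?_
  rw [← ENNReal.ofReal_sum_of_nonneg fun a _ =>
    DirichletBergman.betaFun_nonneg hh (le_of_lt a.2.1)]
  refine ENNReal.ofReal_le_ofReal ?_
  have key := DirichletBergman.sum_betaFun_le hh hext.1 hmaps (by exact_mod_cast hc₀) hlim
    (S.map (Function.Embedding.subtype _)) hs (fun a ha => by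
      obtain ⟨b, -, rfl⟩ := Finset.mem_map.1 ha
      exact b.2)
  rwa [Finset.sum_map] at key
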